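/- **Comparison principles.** Let $H:\mathbb R\to\mathbb R$ be continuous, let $F:\mathbb R\to\mathbb R$ be continuous, non-increasing and semi-coercive, i.e. $\lim_{p\to-\infty}F(p)=+\infty$, and let $u_0:[0,\infty)\to\mathbb R$ be uniformly continuous. Assume that at least one of the following holds: 1. $\lim_{p\to+\infty}F(p)=-\infty$ (no coercivity or convexity of $H$ is required); 2. $H$ is coercive: $\lim_{|p|\to\infty}H(p)=+\infty$. For $T>0$ consider the problem $$u_t+H(u_x)=0\ \text{ for } t\in(0,T),\ x>0,\qquad u_t+F(u_x)=0\ \text{ for } t\in(0,T),\ x=0,\qquad u(0,x)=u_0(x)\ \text{ for } x\ge 0.$$ For $u:[0,T)\times[0,\infty)\to\mathbb R$ let $u^*(t,x)=\limsup_{(s,y)\to(t,x)}u(s,y)$ and $u_*(t,x)=\liminf_{(s,y)\to(t,x)}u(s,y)$ be its semicontinuous envelopes, with values in $[-\infty,+\infty]$, where $(s,y)$ ranges over $[0,T)\times[0,\infty)$ and $(s,y)=(t,x)$ is allowed. The function $u$ is a *relaxed sub-solution* of the problem if * for every $C^1$ function $\phi$ on $(0,T)\times[0,\infty)$ (up to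 the boundary $x=0$) and every $(t_0,x_0)\in(0,T)\times[0,\infty)$ at which $u^*-\phi$ has a local maximum relative to $(0,T)\times[0,\infty)$, one has, at $(t_0,x_0)$, $\phi_t+H(\phi_x)\le0$ if $x_0>0$, and $\phi_t+H(\phi_x)\le 0$ or $\phi_t+F(\phi_x)\le 0$ if $x_0=0$ (where $\phi_x$ is the one-sided derivative); and * $u^*(0,x)\le u_0(x)$ for all $x\ge0$. A *relaxed super-solution* is defined in the same way with $u_*$ in place of $u^*$, local minimum in place of local maximum, and all inequalities reversed. Let $T>0$ and $C_T>0$, let $u$ be a relaxed sub-solution and $v$ a relaxed super-solution of the problem such that $$u(t,x)\le C_T(1+x),\qquad v(t,x)\ge -C_T(1+x)\qquad\text{for all }(t,x)\in(0,T)\times[0,\infty).$$ Then $u\le v$ on $[0,T)\times[0,\infty)$. -/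

import Mathlib

open Set Filter Topology

namespace HalfLineHJ

/-- The space-time domain `[0,T) × [0,∞)`. -/
def dom (T : ℝ) : Set (ℝ × ℝ) := Ico 0 T ×ˢ Ici 0

/-- The set `(0,T) × [0,∞)` on which the equation is posed. -/
def evolDom (T : ℝ) : Set (ℝ × ℝ) := Ioo 0 T ×ˢ Ici 0

/-- Upper semicontinuous envelope `u^*` of `u : [0,T) × [0,∞) → ℝ`, with values in `[-∞,∞]`.
Only the values of `u` on the domain matter, and the centre point is included in the limsup. -/
noncomputable def upperEnv (T : ℝ) (u : ℝ × ℝ → ℝ) (z : ℝ × ℝ) : EReal :=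
  limsup (fun w => (u w : EReal)) (𝓝[dom T] z)

/-- Lower semicontinuous envelope `u_*` of `u : [0,T) × [0,∞) → ℝ`, with values in `[-∞,∞]`. -/
noncomputable def lowerEnv (T : ℝ) (u : ℝ × ℝ → ℝ) (z : ℝ × ℝ) : EReal :=
  liminf (fun w => (u w : EReal)) (𝓝[dom T] z)

/-- Time derivative `φ_t` at `z`. -/
noncomputable def dt (φ : ℝ × ℝ → ℝ) (z : ℝ × ℝ) : ℝ :=
  deriv (fun t => φ (t, z.2)) z.1

/-- Space derivative `φ_x` at `z`, taken in `[0,∞)`; it is one-sided at `x = 0`. -/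
noncomputable def dx (φ : ℝ × ℝ → ℝ) (z : ℝ × ℝ) : ℝ :=
  derivWithin (fun x => φ (z.1, x)) (Ici 0) z.2

/-- Test functions: of class `C¹` on `(0,T) × [0,∞)`, up to the boundary `x = 0`. -/
def IsTest (T : ℝ) (φ : ℝ × ℝ → ℝ) : Prop := ContDiffOn ℝ 1 φ (evolDom T)

/-- `φ` touches `U` from above at `z`: `U - φ` has a local maximum at `z`. -/
def TouchesAbove (T : ℝ) (φ : ℝ × ℝ → ℝ) (U : ℝ × ℝ → EReal) (z : ℝ × ℝ) : Prop :=
  IsLocalMaxOn (fun w => U w - (φ w : EReal)) (evolDom T) z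

/-- `φ` touches `U` from below at `z`: `U - φ` has a local minimum at `z`. -/
def TouchesBelow (T : ℝ) (φ : ℝ × ℝ → ℝ) (U : ℝ × ℝ → EReal) (z : ℝ × ℝ) : Prop :=
  IsLocalMinOn (fun w => U w - (φ w : EReal)) (evolDom T) z

/-- Relaxed sub-solution of `u_t + H(u_x) = 0` for `x > 0`, `u_t + F(u_x) = 0` at `x = 0`,
in `(0,T) × [0,∞)`. -/
def IsRelaxedSub (H F : ℝ → ℝ) (T : ℝ) (u : ℝ × ℝ → ℝ) : Prop :=
  ∀ φ : ℝ × ℝ → ℝ, IsTest T φ → ∀ z ∈ evolDom T, TouchesAbove T φ (upperEnv T u) z →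
    (0 < z.2 → dt φ z + H (dx φ z) ≤ 0) ∧
    (z.2 = 0 → dt φ z + H (dx φ z) ≤ 0 ∨ dt φ z + F (dx φ z) ≤ 0)

/-- Relaxed super-solution of `u_t + H(u_x) = 0` for `x > 0`, `u_t + F(u_x) = 0` at `x = 0`,
in `(0,T) × [0,∞)`. -/
def IsRelaxedSuper (H F : ℝ → ℝ) (T : ℝ) (v : ℝ × ℝ → ℝ) : Prop :=
  ∀ φ : ℝ × ℝ → ℝ, IsTest T φ → ∀ z ∈ evolDom T, TouchesBelow T φ (lowerEnv T v) z →
    (0 < z.2 → 0 ≤ dt φ z + H (dx φ z)) ∧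
    (z.2 = 0 → 0 ≤ dt φ z + H (dx φ z) ∨ 0 ≤ dt φ z + F (dx φ z))

/-- Relaxed sub-solution of the initial value problem with datum `u₀` on `[0,T) × [0,∞)`. -/
def IsRelaxedSubIVP (H F u₀ : ℝ → ℝ) (T : ℝ) (u : ℝ × ℝ → ℝ) : Prop :=
  IsRelaxedSub H F T u ∧ ∀ x : ℝ, 0 ≤ x → upperEnv T u (0, x) ≤ (u₀ x : EReal)

/-- Relaxed super-solution of the initial value problem with datum `u₀` on `[0,T) × [0,∞)`. -/
def IsRelaxedSuperIVP (H F u₀ : ℝ → ℝ) (T : ℝ) (v : ℝ × ℝ → ℝ) : Prop :=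
  IsRelaxedSuper H F T v ∧ ∀ x : ℝ, 0 ≤ x → (u₀ x : EReal) ≤ lowerEnv T v (0, x)

end HalfLineHJ

/-!
The proof doubles the variables, with a penalty tilted according to the time derivative at the
contact point.

Write `U` for the upper envelope of `u` and `W` for the opposite of the lower envelope of `v`; both
are sub-solutions (`exists_viscSub`, `IsRelaxedSuperIVP.neg`), `W` for the Hamiltonians
`p ↦ -H (-p)` and `p ↦ -F (-p)`. Comparison with explicit barriers
(`ViscSub.exists_le_add_mul`) gives, for every `θ > 0`, a bound
`U (t, x) + W (s, y) ≤ θ + K (t + s) + L |x - y|`. It keeps the doubling argument finite on the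
unbounded domain, and excludes contact at the initial time.

If `U + W` were positive somewhere on the diagonal, then
`U (t, x) + W (s, y) - c (t - s)² - N (x - y)² - g (l) (x - y)`, with `l = 2c (t - s)`, corrected by
terms that localize in `x` and away from the final time, would have a positive maximum
(`localization_of_le_doubling`). The time derivative of the penalty at the maximum is close to `l`
once `N` is large, because `x - y` is then small while `c` and `g` are fixed. The function `g` is
a smooth approximate solution of `F (g l) = -l` (`exists_smooth_approx_inverse`). At `x = 0` the
slope of the penalty is at most `g l`, at `y = 0` it is at least `g l`. As `F` is non-increasing,
the boundary inequality for `F` therefore fails both for `U` and for `W`, by a margin provided by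
the terms `η / (T - t)` and `η / (T - s)`. Both functions thus satisfy the inequality for `H`, at
nearly the same bounded slope, which is contradictory (`false_of_isMax_doubling`).

If `F` is bounded below, `F (g l) = -l` may have no solution. In this case `H` is coercive, and the
inequality for `H` already obtained for `U` bounds the slope from above. So `F` may be lowered
beyond that bound without affecting the argument (`exists_coercive_modification`).
-/

namespace HalfLineHJ

/-! ### Semicontinuous envelopes and real-valued sub-solutions -/

/-- The viscosity inequalities for a relaxed sub-solution, for a real-valued function `U`. The test
function enters through its two partial derivatives `a` and `b` at the contact point. -/
def ViscSub (H F : ℝ → ℝ) (T : ℝ) (U : ℝ × ℝ → ℝ) : Prop :=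
  ∀ (φ : ℝ × ℝ → ℝ) (a b : ℝ) (z : ℝ × ℝ), IsTest T φ → z ∈ evolDom T →
    IsLocalMaxOn (fun w => U w - φ w) (evolDom T) z →
    HasDerivAt (fun t => φ (t, z.2)) a z.1 → HasDerivAt (fun x => φ (z.1, x)) b z.2 →
    a + H b ≤ 0 ∨ (z.2 = 0 ∧ a + F b ≤ 0)

lemma evolDom_subset_dom (T : ℝ) : evolDom T ⊆ dom T :=
  prod_mono Ioo_subset_Ico_self subset_rfl

lemma upperSemicontinuous_upperEnv (T : ℝ) (u : ℝ × ℝ → ℝ) :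
    UpperSemicontinuous (upperEnv T u) := by
  intro z c hc
  obtain ⟨c', h1, h2⟩ := exists_between hc
  have h3 : ∀ᶠ w in 𝓝[dom T] z, (u w : EReal) < c' := eventually_lt_of_limsup_lt h1
  rw [← eventually_nhds_nhdsWithin] at h3
  filter_upwards [h3] with y hy
  exact (limsup_le_of_le (by isBoundedDefault) (hy.mono fun _ h => h.le)).trans_lt h2

lemma le_upperEnv {T : ℝ} (u : ℝ × ℝ → ℝ) {z : ℝ × ℝ} (hz : z ∈ dom T) :
    (u z : EReal) ≤ upperEnv T u z := by
  refine le_limsup_of_frequently_le ?_ (by isBoundedDefault)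
  intro h
  exact (pure_le_nhdsWithin hz h) le_rfl

lemma upperEnv_le {T : ℝ} {u g : ℝ × ℝ → ℝ} {z : ℝ × ℝ} (hg : Continuous g)
    (h : ∀ᶠ w in 𝓝[dom T] z, u w ≤ g w) : upperEnv T u z ≤ g z := by
  refine le_of_forall_gt_imp_ge_of_dense fun c hc => ?_
  have h2 : ∀ᶠ w in 𝓝 z, (g w : EReal) < c :=
    (continuous_coe_real_ereal.comp hg).continuousAt.eventually_lt_const hc
  refine limsup_le_of_le (by isBoundedDefault) ?_
  filter_upwards [h, nhdsWithin_le_nhds h2] with w h3 h4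
  exact (EReal.coe_le_coe_iff.2 h3).trans h4.le

/-- A relaxed sub-solution with at most linear growth has a finite upper envelope, so it may be
replaced by a real-valued upper semicontinuous function. -/
lemma exists_viscSub {H F u₀ : ℝ → ℝ} {T C : ℝ} {u : ℝ × ℝ → ℝ}
    (hu : IsRelaxedSubIVP H F u₀ T u)
    (hub : ∀ t ∈ Ioo 0 T, ∀ x : ℝ, 0 ≤ x → u (t, x) ≤ C * (1 + x)) :
    ∃ U : ℝ × ℝ → ℝ, UpperSemicontinuousOn U (dom T) ∧ (∀ z ∈ dom T, u z ≤ U z) ∧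
      (∀ z ∈ evolDom T, U z ≤ C * (1 + z.2)) ∧ (∀ x, 0 ≤ x → 0 < T → U (0, x) ≤ u₀ x) ∧
      ViscSub H F T U := by
  have hle : ∀ z ∈ evolDom T, upperEnv T u z ≤ ((C * (1 + z.2) : ℝ) : EReal) := by
    intro z hz
    refine upperEnv_le (g := fun z => C * (1 + z.2)) (by fun_prop) ?_
    have h1 : ∀ᶠ w : ℝ × ℝ in 𝓝 z, w.1 ∈ Ioo 0 T :=
      continuous_fst.continuousAt.eventually (isOpen_Ioo.mem_nhds hz.1)
    filter_upwards [nhdsWithin_le_nhds h1, self_mem_nhdsWithin] with w h2 h3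
    exact hub w.1 h2 w.2 h3.2
  have hcoe : ∀ z ∈ dom T, ((upperEnv T u z).toReal : EReal) = upperEnv T u z := by
    intro z hz
    refine EReal.coe_toReal ?_ ?_
    · rcases eq_or_lt_of_le hz.1.1 with h0 | h0
      · have : z = (0, z.2) := Prod.ext h0.symm rfl
        rw [this]
        exact ((hu.2 z.2 hz.2).trans_lt (EReal.coe_lt_top _)).ne
      · exact ((hle z ⟨⟨h0, hz.1.2⟩, hz.2⟩).trans_lt (EReal.coe_lt_top _)).ne
    · exact ((EReal.bot_lt_coe _).trans_le (le_upperEnv u hz)).ne'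
  refine ⟨fun z => (upperEnv T u z).toReal, ?_, ?_, ?_, ?_, ?_⟩
  · intro z hz c hc
    have h1 : upperEnv T u z < (c : EReal) := by
      rw [← hcoe z hz]; exact EReal.coe_lt_coe_iff.2 hc
    filter_upwards [nhdsWithin_le_nhds (upperSemicontinuous_upperEnv T u z _ h1),
      self_mem_nhdsWithin] with w h2 h3
    rw [← hcoe w h3] at h2
    exact EReal.coe_lt_coe_iff.1 h2
  · intro z hz
    rw [← EReal.coe_le_coe_iff, hcoe z hz]
    exact le_upperEnv u hz
  · intro z hz
    rw [← EReal.coe_le_coe_iff, hcoe z (evolDom_subset_dom T hz)]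
    exact hle z hz
  · intro x hx hT
    rw [← EReal.coe_le_coe_iff, hcoe (0, x) ⟨⟨le_rfl, hT⟩, hx⟩]
    exact hu.2 x hx
  · intro φ a b z hφ hz hmax ha hb
    have htouch : TouchesAbove T φ (upperEnv T u) z := by
      unfold TouchesAbove IsLocalMaxOn IsMaxFilter
      filter_upwards [hmax, self_mem_nhdsWithin] with w h1 h2
      rw [← hcoe w (evolDom_subset_dom T h2), ← hcoe z (evolDom_subset_dom T hz)]
      exact_mod_cast h1
    have h := hu.1 φ hφ z hz htouch
    have hdt : dt φ z = a := ha.deriv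
    have hdx : dx φ z = b :=
      hb.hasDerivWithinAt.derivWithin (uniqueDiffOn_Ici 0 z.2 hz.2)
    rw [hdt, hdx] at h
    rcases eq_or_lt_of_le (show (0 : ℝ) ≤ z.2 from hz.2) with h0 | h0
    · exact (h.2 h0.symm).imp_right fun h => ⟨h0.symm, h⟩
    · exact Or.inl (h.1 h0)

lemma lowerEnv_eq_neg (T : ℝ) (v : ℝ × ℝ → ℝ) (z : ℝ × ℝ) :
    lowerEnv T v z = -upperEnv T (fun w => -v w) z := by
  have : (fun w => ((-v w : ℝ) : EReal)) = -(fun w => (v w : EReal)) := by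
    ext w; simp
  rw [lowerEnv, upperEnv, this, EReal.limsup_neg, neg_neg]

/-- The map `v ↦ -v` turns super-solutions for `(H, F)` into sub-solutions for the Hamiltonians
`p ↦ -H (-p)` and `p ↦ -F (-p)`. -/
lemma IsRelaxedSuperIVP.neg {H F u₀ : ℝ → ℝ} {T : ℝ} {v : ℝ × ℝ → ℝ}
    (hv : IsRelaxedSuperIVP H F u₀ T v) :
    IsRelaxedSubIVP (fun p => -H (-p)) (fun p => -F (-p)) (fun x => -u₀ x) T
      (fun z => -v z) := by
  refine ⟨fun φ hφ z hz htouch => ?_, fun x hx => ?_⟩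
  · have h1 : TouchesBelow T (fun w => -φ w) (lowerEnv T v) z := by
      unfold TouchesBelow IsLocalMinOn IsMinFilter
      have key : ∀ w, lowerEnv T v w - ((-φ w : ℝ) : EReal)
          = -(upperEnv T (fun w => -v w) w - (φ w : EReal)) := by
        intro w
        rw [lowerEnv_eq_neg, EReal.neg_sub (Or.inr (EReal.coe_ne_bot _))
          (Or.inr (EReal.coe_ne_top _)), EReal.coe_neg, sub_eq_add_neg, neg_neg]
      filter_upwards [htouch] with w h1
      rw [key, key]
      exact EReal.neg_le_neg_iff.2 h1
    have h2 := hv.1 (fun w => -φ w) (ContDiffOn.neg hφ) z hz h1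
    have hdt : dt (fun w => -φ w) z = -dt φ z := deriv.fun_neg
    have hdx : dx (fun w => -φ w) z = -dx φ z := derivWithin.fun_neg
    rw [hdt, hdx] at h2
    refine ⟨fun h => ?_, fun h => ?_⟩
    · have := h2.1 h
      linarith
    · refine (h2.2 h).imp (fun h => ?_) (fun h => ?_) <;> linarith
  · have := hv.2 x hx
    rw [lowerEnv_eq_neg] at this
    rw [EReal.coe_neg]
    exact EReal.le_neg_of_le_neg this

/-! ### Auxiliary facts from real analysis -/

/-- An upper semicontinuous function attains its maximum if one of its superlevel sets is contained
in a compact set. -/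
lemma exists_forall_le_of_superlevel_subset {X : Type*} [TopologicalSpace X] {f : X → ℝ}
    {S K : Set X} (hK : IsCompact K) (hKS : K ⊆ S) (hf : UpperSemicontinuousOn f K) {z₀ : X}
    (h₀ : z₀ ∈ S) (h : ∀ z ∈ S, f z₀ ≤ f z → z ∈ K) : ∃ z ∈ S, ∀ w ∈ S, f w ≤ f z := by
  have h1 : z₀ ∈ K := h z₀ h₀ le_rfl
  obtain ⟨z, hz, hmax⟩ := hf.exists_isMaxOn ⟨z₀, h1⟩ hK
  refine ⟨z, hKS hz, fun w hw => ?_⟩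
  rcases le_total (f z₀) (f w) with h2 | h2
  · exact hmax (h w hw h2)
  · exact h2.trans (hmax h1)

/-- A smooth approximation `√(κ² + x²)` of `|x|`. -/
noncomputable def softAbs (κ x : ℝ) : ℝ := √(κ ^ 2 + x ^ 2)

lemma contDiff_softAbs {κ : ℝ} (hκ : 0 < κ) : ContDiff ℝ 1 (softAbs κ) :=
  ContDiff.sqrt (by fun_prop) fun x => by positivity

lemma hasDerivAt_softAbs {κ : ℝ} (hκ : 0 < κ) (x : ℝ) :
    HasDerivAt (softAbs κ) (x / softAbs κ x) x := by
  have h1 : HasDerivAt (fun x : ℝ => κ ^ 2 + x ^ 2) (2 * x) x := by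
    simpa using (hasDerivAt_pow 2 x).const_add (κ ^ 2)
  exact (h1.sqrt (by positivity)).congr_deriv (mul_div_mul_left _ _ two_ne_zero)

lemma softAbs_pos {κ : ℝ} (hκ : 0 < κ) (x : ℝ) : 0 < softAbs κ x :=
  Real.sqrt_pos.2 (by positivity)

lemma abs_le_softAbs (κ x : ℝ) : |x| ≤ softAbs κ x :=
  Real.abs_le_sqrt (by nlinarith [sq_nonneg κ])

lemma softAbs_zero {κ : ℝ} (hκ : 0 < κ) : softAbs κ 0 = κ := by
  simp [softAbs, Real.sqrt_sq hκ.le]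

lemma abs_div_softAbs_le {κ : ℝ} (hκ : 0 < κ) (x : ℝ) : |x / softAbs κ x| ≤ 1 := by
  rw [abs_div, abs_of_pos (softAbs_pos hκ x), div_le_one (softAbs_pos hκ x)]
  exact abs_le_softAbs κ x

lemma exists_abs_le_of_abs_le {H : ℝ → ℝ} (hH : Continuous H) (L : ℝ) :
    ∃ B, 0 ≤ B ∧ ∀ p, |p| ≤ L → |H p| ≤ B := by
  obtain ⟨B, hB⟩ := (isCompact_Icc (a := -L) (b := L)).exists_bound_of_continuousOn
    hH.continuousOn
  exact ⟨|B|, abs_nonneg B, fun p hp => (hB p (abs_le.1 hp)).trans (le_abs_self B)⟩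

/-- A uniformly continuous function on the half-line is Lipschitz up to an arbitrarily small
error. -/
lemma exists_lipschitz_add_error {w : ℝ → ℝ} (hw : UniformContinuousOn w (Ici 0)) {δ : ℝ}
    (hδ : 0 < δ) : ∃ L, 0 ≤ L ∧ ∀ x y, 0 ≤ x → 0 ≤ y → |w x - w y| ≤ δ + L * |x - y| := by
  obtain ⟨r, hr, h⟩ := Metric.uniformContinuousOn_iff.1 hw δ hδ
  have key : ∀ n : ℕ, ∀ x y, 0 ≤ x → x ≤ y → y - x ≤ n * (r / 2) → |w x - w y| ≤ n * δ := by
    intro n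
    induction n with
    | zero =>
      intro x y hx hxy h1
      have : x = y := by simp at h1; linarith
      simp [this]
    | succ n ih =>
      intro x y hx hxy h1
      push_cast at h1 ⊢
      -- the path from `x` to `y` is cut at `z`, so that one step has length at most `r / 2`
      set z := max x (y - r / 2) with hz
      have hxz : x ≤ z := le_max_left _ _
      have hzy : z ≤ y := max_le hxy (by linarith)
      have hyz : y - r / 2 ≤ z := le_max_right _ _
      have h2 : |w x - w z| ≤ n * δ := by
        refine ih x z hx hxz ?_
        have : z ≤ x + n * (r / 2) :=
          max_le (le_add_of_nonneg_right (by positivity)) (by linarith)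
        linarith
      have h3 : |w z - w y| < δ := by
        rw [← Real.dist_eq]
        refine h z (hx.trans hxz) y (hx.trans hxy) ?_
        rw [Real.dist_eq, abs_lt]
        constructor <;> linarith
      calc |w x - w y| ≤ |w x - w z| + |w z - w y| := abs_sub_le _ _ _
        _ ≤ (n + 1) * δ := by linarith
  refine ⟨2 / r * δ, by positivity, ?_⟩
  have main : ∀ x y, 0 ≤ x → x ≤ y → |w x - w y| ≤ δ + 2 / r * δ * |x - y| := by
    intro x y hx hxy
    have h1 := Nat.le_ceil ((y - x) / (r / 2))
    have h2 := Nat.ceil_lt_add_one (show 0 ≤ (y - x) / (r / 2) from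
      div_nonneg (sub_nonneg.2 hxy) (by positivity))
    rw [div_le_iff₀ (by positivity)] at h1
    refine (key _ x y hx hxy h1).trans ?_
    rw [abs_sub_comm x y, abs_of_nonneg (sub_nonneg.2 hxy)]
    have h3 : (y - x) / (r / 2) = 2 / r * (y - x) := by field_simp
    rw [h3] at h2
    rw [h3]
    nlinarith
  intro x y hx hy
  rcases le_total x y with hxy | hxy
  · exact main x y hx hxy
  · rw [abs_sub_comm (w x), abs_sub_comm x]
    exact main y x hy hxy

/-! ### Comparison with barriers near the initial time -/

/-- A sub-solution of at most linear growth leaves its initial datum with bounded speed, up to an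
arbitrarily small error. It is compared with
`u₀ x₀ + δ + L √(κ² + (x - x₀)²) + K t + η / (T - t)`, a strict classical super-solution as soon as
`K` exceeds `|H|` and `|F|` on `[-L, L]`; neither coercivity nor the sign of `F` is used. -/
lemma ViscSub.exists_le_add_mul {H F u₀ : ℝ → ℝ} {T C L δ : ℝ} {U : ℝ × ℝ → ℝ}
    (hH : Continuous H) (hF : Continuous F) (hU : ViscSub H F T U)
    (husc : UpperSemicontinuousOn U (dom T))
    (hgrow : ∀ z ∈ evolDom T, U z ≤ C * (1 + z.2)) (hini : ∀ x, 0 ≤ x → U (0, x) ≤ u₀ x)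
    (hL : 0 ≤ L) (hCL : C < L)
    (hmod : ∀ x y, 0 ≤ x → 0 ≤ y → u₀ x ≤ u₀ y + δ + L * |x - y|) :
    ∃ K, 0 ≤ K ∧ ∀ z ∈ dom T, U z ≤ u₀ z.2 + δ + K * z.1 := by
  obtain ⟨B₁, hB₁, hHB⟩ := exists_abs_le_of_abs_le hH L
  obtain ⟨B₂, hB₂, hFB⟩ := exists_abs_le_of_abs_le hF L
  refine ⟨B₁ + B₂, by positivity, ?_⟩
  set K := B₁ + B₂ with hK
  by_contra! hcon
  obtain ⟨⟨t₁, x₀⟩, ⟨⟨ht₁, ht₁T⟩, hx₀⟩, hlt⟩ := hcon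
  simp only [mem_Ici] at ht₁ ht₁T hx₀ hlt
  set m := U (t₁, x₀) - (u₀ x₀ + δ + K * t₁) with hm
  have hm0 : 0 < m := sub_pos.2 hlt
  have hTt : 0 < T - t₁ := sub_pos.2 ht₁T
  set κ := m / (4 * (L + 1)) with hκ
  have hκ0 : 0 < κ := by positivity
  have hLκ : L * κ ≤ m / 4 := by
    rw [hκ, mul_div_assoc', div_le_div_iff₀ (by positivity) (by positivity)]
    nlinarith
  set η := (T - t₁) * (m / 4) with hη
  have hη0 : 0 < η := by positivity
  set w : ℝ × ℝ → ℝ :=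
    fun z => u₀ x₀ + δ + L * softAbs κ (z.2 - x₀) + K * z.1 + η / (T - z.1) with hw
  have href : 0 < U (t₁, x₀) - w (t₁, x₀) := by
    have h1 : η / (T - t₁) = m / 4 := by rw [hη]; field_simp
    simp only [hw, sub_self, softAbs_zero hκ0, h1]
    linarith
  have hK0 : 0 ≤ K := by positivity
  -- a point where `U` exceeds the barrier has positive time and lies in a fixed compact set
  have hini' : ∀ z ∈ dom T, 0 < U z - w z → 0 < z.1 := by
    intro z hz hpos
    refine lt_of_le_of_ne hz.1.1 fun h0 => ?_
    have h1 : U z ≤ u₀ z.2 := by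
      have := hini z.2 hz.2
      rwa [h0] at this
    have h2 := hmod z.2 x₀ hz.2 hx₀
    have h3 := mul_le_mul_of_nonneg_left (abs_le_softAbs κ (z.2 - x₀)) hL
    have h4 : 0 < η / (T - z.1) := div_pos hη0 (sub_pos.2 hz.1.2)
    have h5 : 0 ≤ K * z.1 := mul_nonneg hK0 hz.1.1
    simp only [hw] at hpos
    linarith
  set E := C + L * x₀ - u₀ x₀ - δ with hE
  have hloc : ∀ z ∈ dom T, 0 < U z - w z → (L - C) * z.2 ≤ E ∧ η ≤ E * (T - z.1) := by
    intro z hz hpos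
    have h0 := hini' z hz hpos
    have h1 := hgrow z ⟨⟨h0, hz.1.2⟩, hz.2⟩
    have h3 := mul_le_mul_of_nonneg_left
      ((le_abs_self (z.2 - x₀)).trans (abs_le_softAbs κ (z.2 - x₀))) hL
    have hT' : 0 < T - z.1 := sub_pos.2 hz.1.2
    have h4 : 0 < η / (T - z.1) := div_pos hη0 hT'
    have h5 : 0 ≤ K * z.1 := mul_nonneg hK0 hz.1.1
    have h6 : 0 ≤ (L - C) * z.2 := mul_nonneg (sub_pos.2 hCL).le hz.2
    simp only [hw] at hpos
    constructor
    · linarith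
    · rw [← div_le_iff₀ hT']
      linarith
  have hE0 : 0 < E := by
    have := (hloc (t₁, x₀) ⟨⟨ht₁, ht₁T⟩, hx₀⟩ href).2
    exact pos_of_mul_pos_left (hη0.trans_le this) hTt.le
  have hLC : 0 < L - C := sub_pos.2 hCL
  have hcontw : ContinuousOn w (dom T) := by
    have h1 : Continuous (softAbs κ) := (contDiff_softAbs hκ0).continuous
    refine ContinuousOn.add (by fun_prop) (ContinuousOn.div (by fun_prop) (by fun_prop) ?_)
    intro z hz
    exact (sub_pos.2 hz.1.2).ne'
  have hsub : Icc 0 (T - η / E) ×ˢ Icc 0 (E / (L - C)) ⊆ dom T := by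
    intro z hz
    have : 0 < η / E := by positivity
    exact ⟨⟨hz.1.1, by linarith [hz.1.2]⟩, hz.2.1⟩
  obtain ⟨z, hz, hmax⟩ := exists_forall_le_of_superlevel_subset (f := fun z => U z - w z)
    (S := dom T) (z₀ := (t₁, x₀)) (isCompact_Icc.prod isCompact_Icc) hsub
    (by
      have := (husc.mono hsub).add (hcontw.mono hsub).neg.upperSemicontinuousOn
      simpa only [sub_eq_add_neg] using! this)
    ⟨⟨ht₁, ht₁T⟩, hx₀⟩ (by
      intro z hz hle
      have h1 := hloc z hz (href.trans_le hle)
      refine ⟨⟨hz.1.1, ?_⟩, ⟨hz.2, ?_⟩⟩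
      · have : η / E ≤ T - z.1 := by rw [div_le_iff₀ hE0]; linarith
        linarith
      · rw [le_div_iff₀ hLC]; linarith)
  have hpos : 0 < U z - w z := href.trans_le (hmax (t₁, x₀) ⟨⟨ht₁, ht₁T⟩, hx₀⟩)
  have hz0 := hini' z hz hpos
  have hT' : 0 < T - z.1 := sub_pos.2 hz.1.2
  have hz' : z ∈ evolDom T := ⟨⟨hz0, hz.1.2⟩, hz.2⟩
  have htest : IsTest T w := by
    have h1 := contDiff_softAbs hκ0
    refine ContDiffOn.add (ContDiff.contDiffOn (by fun_prop)) (ContDiffOn.div (by fun_prop)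
      (by fun_prop) ?_)
    intro z hz
    exact (sub_pos.2 hz.1.2).ne'
  have hlocmax : IsLocalMaxOn (fun y => U y - w y) (evolDom T) z :=
    eventually_of_mem self_mem_nhdsWithin fun y hy => hmax y (evolDom_subset_dom T hy)
  have hdt : HasDerivAt (fun t => w (t, z.2)) (K + η / (T - z.1) ^ 2) z.1 := by
    have h1 : HasDerivAt (fun t : ℝ => T - t) (-1) z.1 := by
      simpa using (hasDerivAt_id z.1).const_sub T
    have h2 := (((hasDerivAt_id z.1).const_mul K).const_add
      (u₀ x₀ + δ + L * softAbs κ (z.2 - x₀))).add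
      ((hasDerivAt_const z.1 η).div h1 hT'.ne')
    exact h2.congr_deriv (by simp)
  have hdx : HasDerivAt (fun x => w (z.1, x))
      (L * ((z.2 - x₀) / softAbs κ (z.2 - x₀))) z.2 := by
    have h1 := (hasDerivAt_softAbs hκ0 (z.2 - x₀)).comp_sub_const z.2 x₀
    exact (((h1.const_mul L).const_add (u₀ x₀ + δ)).add_const (K * z.1)).add_const
      (η / (T - z.1))
  have hslope : |L * ((z.2 - x₀) / softAbs κ (z.2 - x₀))| ≤ L := by
    rw [abs_mul, abs_of_nonneg hL]
    exact mul_le_of_le_one_right hL (abs_div_softAbs_le hκ0 _)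
  have h1 := neg_le_of_abs_le (hHB _ hslope)
  have h2 := neg_le_of_abs_le (hFB _ hslope)
  have h3 : 0 < η / (T - z.1) ^ 2 := by positivity
  rcases hU w _ _ z htest hz' hlocmax hdt hdx with h | ⟨-, h⟩ <;> linarith

/-! ### The slope prescribed by the boundary condition -/

/-- Both alternatives on `(H, F)` allow replacing `F` by a smaller `G` that tends to `-∞` at `+∞`
and agrees with `F` at every slope compatible with the inequality `H ≤ B`. If `H` is coercive, such
slopes are bounded above, and `F` is lowered beyond that bound. -/
lemma exists_coercive_modification {H F : ℝ → ℝ} (hF : Continuous F) (hFmono : Antitone F)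
    (hFsemi : Tendsto F atBot atTop)
    (hcase : Tendsto F atTop atBot ∨ Tendsto H (cocompact ℝ) atTop) (B : ℝ) :
    ∃ G : ℝ → ℝ, Continuous G ∧ Antitone G ∧ Tendsto G atBot atTop ∧ Tendsto G atTop atBot ∧
      (∀ q, G q ≤ F q) ∧ ∀ q a, 0 ≤ a → H (q + a) ≤ B → G q = F q := by
  rcases hcase with h | h
  · exact ⟨F, hF, hFmono, hFsemi, h, fun _ => le_rfl, fun _ _ _ _ => rfl⟩
  · have h1 : ∀ᶠ p in atTop, B < H p := (h.mono_left atTop_le_cocompact).eventually_gt_atTop B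
    obtain ⟨R, hR⟩ := eventually_atTop.1 h1
    have hlow : ∀ q, q ≤ R → F q - max (q - R) 0 = F q := fun q hq => by
      rw [max_eq_right (sub_nonpos.2 hq), sub_zero]
    refine ⟨fun q => F q - max (q - R) 0, by fun_prop, ?_, ?_, ?_, ?_, ?_⟩
    · intro p q hpq
      exact sub_le_sub (hFmono hpq) (max_le_max (by linarith) le_rfl)
    · refine hFsemi.congr' ?_
      filter_upwards [eventually_le_atBot R] with q hq
      exact (hlow q hq).symm
    · have h2 : Tendsto (fun q : ℝ => F R + R - q) atTop atBot :=
        tendsto_atBot_add_const_left _ _ tendsto_neg_atTop_atBot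
      refine tendsto_atBot_mono' _ ?_ h2
      filter_upwards [eventually_ge_atTop R] with q hq
      have := hFmono hq
      have := le_max_left (q - R) 0
      linarith
    · intro q
      have := le_max_right (q - R) 0
      linarith
    · intro q a ha hq
      refine hlow q ?_
      by_contra! hlt
      exact absurd (hR (q + a) (by linarith)) (not_lt.2 hq)

/-- The equation `G p = -l` can be solved, up to a small error, by a slope depending smoothly on
`l`. Monotonicity makes the set of approximate solutions convex, so that local constant solutions
are glued by a partition of unity. -/
lemma exists_smooth_approx_inverse {G : ℝ → ℝ} (hG : Continuous G) (hGmono : Antitone G)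
    (hbot : Tendsto G atBot atTop) (htop : Tendsto G atTop atBot) {δ : ℝ} (hδ : 0 < δ) :
    ∃ g : ℝ → ℝ, ContDiff ℝ 1 g ∧ ∀ l, |G (g l) + l| < δ := by
  have hconv : ∀ l : ℝ, Convex ℝ {p : ℝ | |G p + l| < δ} := by
    refine fun l => OrdConnected.convex ⟨fun p hp q hq r hr => ?_⟩
    have h1 : |G p + l| < δ := hp
    have h2 : |G q + l| < δ := hq
    have h3 := hGmono hr.1
    have h4 := hGmono hr.2
    rw [abs_lt] at h1 h2
    show |G r + l| < δ
    exact abs_lt.2 ⟨by linarith, by linarith⟩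
  have hloc : ∀ l : ℝ, ∃ p : ℝ, ∀ᶠ y in 𝓝 l, p ∈ {p : ℝ | |G p + y| < δ} := by
    intro l
    obtain ⟨p, hp⟩ := hG.surjective' hbot htop (-l)
    refine ⟨p, ?_⟩
    have hc : Continuous fun y : ℝ => |G p + y| := by fun_prop
    refine hc.continuousAt.eventually_lt_const ?_
    simpa [hp] using hδ
  obtain ⟨g, hg⟩ := exists_contMDiffMap_forall_mem_convex_of_local_const
    (n := 1) (modelWithCornersSelf ℝ ℝ) hconv hloc
  exact ⟨g, g.contMDiff.contDiff, hg⟩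

/-! ### Doubling of variables -/

/-- The penalty of the doubling argument, at the pair of points `p.1 = (t, x)`, `p.2 = (s, y)`.
The linear term with coefficient `g (2c(t - s))` tilts the slope at a contact point: the time
derivative there is close to `2c(t - s)`, and `g` assigns to it the slope at which the boundary
condition changes sign. -/
noncomputable def penalty (g : ℝ → ℝ) (T c N α η : ℝ) (p : (ℝ × ℝ) × (ℝ × ℝ)) : ℝ :=
  c * (p.1.1 - p.2.1) ^ 2 + N * (p.1.2 - p.2.2) ^ 2
    + g (2 * c * (p.1.1 - p.2.1)) * (p.1.2 - p.2.2)
    + α * softAbs 1 p.1.2 + η / (T - p.1.1) + η / (T - p.2.1)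

lemma contDiffOn_penalty {g : ℝ → ℝ} (hg : ContDiff ℝ 1 g) (T c N α η : ℝ) :
    ContDiffOn ℝ 1 (penalty g T c N α η) (dom T ×ˢ dom T) := by
  have h1 := contDiff_softAbs one_pos
  refine ContDiffOn.add (ContDiffOn.add (ContDiff.contDiffOn (by fun_prop))
    (ContDiffOn.div (by fun_prop) (by fun_prop) ?_)) (ContDiffOn.div (by fun_prop) (by fun_prop) ?_)
  · exact fun p hp => (sub_pos.2 hp.1.1.2).ne'
  · exact fun p hp => (sub_pos.2 hp.2.1.2).ne'

lemma hasDerivAt_div_sub {T η t : ℝ} (ht : t < T) :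
    HasDerivAt (fun t => η / (T - t)) (η / (T - t) ^ 2) t := by
  have h1 : HasDerivAt (fun t : ℝ => T - t) (-1) t := by
    simpa using (hasDerivAt_id t).const_sub T
  exact ((hasDerivAt_const t η).div h1 (sub_pos.2 ht).ne').congr_deriv (by simp)

/-- At an interior-in-time maximum of the doubled function the viscosity inequalities are
incompatible. With `l = 2c(t - s)` the slope `q` of the penalty satisfies `q ≤ g l` if `x = 0` and
`q ≥ g l` if `y = 0`, and `G (g l)` is close to `-l`. As `F ≥ G`, the inequality given by `F` fails
for `U`, so the one given by `H` holds. That one forces `F q = G q`, so the inequality given by `F`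
fails for `W` as well, and the two inequalities given by `H` at nearly the same slope contradict
each other. -/
lemma false_of_isMax_doubling {H F G g : ℝ → ℝ} {T c N α η δ B : ℝ} {U W : ℝ × ℝ → ℝ}
    {z w : ℝ × ℝ} (hU : ViscSub H F T U)
    (hW : ViscSub (fun p => -H (-p)) (fun p => -F (-p)) T W)
    (hGmono : Antitone G) (hGF : ∀ q, G q ≤ F q)
    (hGB : ∀ q a, 0 ≤ a → H (q + a) ≤ B → G q = F q) (hg : ContDiff ℝ 1 g)
    (hgG : ∀ l, |G (g l) + l| < δ) (hN : 0 ≤ N) (hα : 0 ≤ α) (hη : 4 * δ * T ^ 2 ≤ η)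
    (hz : z ∈ evolDom T) (hw : w ∈ evolDom T)
    (hmax : ∀ z' ∈ dom T, ∀ w' ∈ dom T,
      U z' + W w' - penalty g T c N α η (z', w') ≤ U z + W w - penalty g T c N α η (z, w))
    (hg' : |deriv g (2 * c * (z.1 - w.1)) * (2 * c) * (z.2 - w.2)| ≤ δ)
    (hB : |2 * c * (z.1 - w.1)| + δ ≤ B)
    (hHq : ∀ a, |a| ≤ α → |H (2 * N * (z.2 - w.2) + g (2 * c * (z.1 - w.1)) + a)
      - H (2 * N * (z.2 - w.2) + g (2 * c * (z.1 - w.1)))| < 8 * δ) : False := by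
  have hzd := evolDom_subset_dom T hz
  have hwd := evolDom_subset_dom T hw
  have hx0 : 0 ≤ z.2 := hz.2
  have hy0 : 0 ≤ w.2 := hw.2
  have hδ : 0 < δ := (abs_nonneg _).trans_lt (hgG 0)
  have hP := contDiffOn_penalty hg T c N α η
  set l := 2 * c * (z.1 - w.1) with hl
  set e := deriv g l * (2 * c) * (z.2 - w.2) with he
  set q := 2 * N * (z.2 - w.2) + g l with hq
  set a := α * (z.2 / softAbs 1 z.2) with ha
  have hgl : HasDerivAt g (deriv g l) l := (hg.differentiable one_ne_zero l).hasDerivAt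
  have ha0 : 0 ≤ a := mul_nonneg hα (div_nonneg hx0 (softAbs_pos one_pos _).le)
  have haα : |a| ≤ α := by
    rw [ha, abs_mul, abs_of_nonneg hα]
    exact mul_le_of_le_one_right hα (abs_div_softAbs_le one_pos _)
  -- the inequality for `U`
  have hsub : (l + e + η / (T - z.1) ^ 2) + H (q + a) ≤ 0 ∨
      (z.2 = 0 ∧ (l + e + η / (T - z.1) ^ 2) + F (q + a) ≤ 0) := by
    refine hU (fun v => penalty g T c N α η (v, w)) _ _ z ?_ hz ?_ ?_ ?_
    · exact hP.comp (ContDiff.contDiffOn (by fun_prop))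
        fun v hv => ⟨evolDom_subset_dom T hv, hwd⟩
    · refine eventually_of_mem self_mem_nhdsWithin fun v hv => ?_
      have := hmax v (evolDom_subset_dom T hv) w hwd
      show U v - penalty g T c N α η (v, w) ≤ U z - penalty g T c N α η (z, w)
      linarith
    · have h1 : HasDerivAt (fun t => t - w.1) 1 z.1 := (hasDerivAt_id z.1).sub_const w.1
      have h2 : HasDerivAt (fun t => g (2 * c * (t - w.1))) (deriv g l * (2 * c * 1)) z.1 :=
        HasDerivAt.comp z.1 hgl (h1.const_mul (2 * c))
      have h3 := ((((((h1.pow 2).const_mul c).add_const (N * (z.2 - w.2) ^ 2)).add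
        (h2.mul_const (z.2 - w.2))).add_const (α * softAbs 1 z.2)).add
        (hasDerivAt_div_sub (η := η) hz.1.2)).add_const (η / (T - w.1))
      exact h3.congr_deriv (by rw [he, hl]; push_cast; ring)
    · have h1 : HasDerivAt (fun x => x - w.2) 1 z.2 := (hasDerivAt_id z.2).sub_const w.2
      have h3 := ((((((h1.pow 2).const_mul N).const_add (c * (z.1 - w.1) ^ 2)).add
        (h1.const_mul (g l))).add ((hasDerivAt_softAbs one_pos z.2).const_mul α)).add_const
        (η / (T - z.1))).add_const (η / (T - w.1))
      exact h3.congr_deriv (by rw [hq, ha]; push_cast; ring)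
  -- the inequality for `W`
  have hsup : (-(l + e) + η / (T - w.1) ^ 2) + -H (- -q) ≤ 0 ∨
      (w.2 = 0 ∧ (-(l + e) + η / (T - w.1) ^ 2) + -F (- -q) ≤ 0) := by
    refine hW (fun v => penalty g T c N α η (z, v)) _ _ w ?_ hw ?_ ?_ ?_
    · exact hP.comp (ContDiff.contDiffOn (by fun_prop))
        fun v hv => ⟨hzd, evolDom_subset_dom T hv⟩
    · refine eventually_of_mem self_mem_nhdsWithin fun v hv => ?_
      have := hmax z hzd v (evolDom_subset_dom T hv)
      show W v - penalty g T c N α η (z, v) ≤ W w - penalty g T c N α η (z, w)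
      linarith
    · have h1 : HasDerivAt (fun s => z.1 - s) (-1) w.1 := by
        simpa using (hasDerivAt_id w.1).const_sub z.1
      have h2 : HasDerivAt (fun s => g (2 * c * (z.1 - s))) (deriv g l * (2 * c * -1)) w.1 :=
        HasDerivAt.comp w.1 hgl (h1.const_mul (2 * c))
      have h3 := ((((((h1.pow 2).const_mul c).add_const (N * (z.2 - w.2) ^ 2)).add
        (h2.mul_const (z.2 - w.2))).add_const (α * softAbs 1 z.2)).add_const
        (η / (T - z.1))).add (hasDerivAt_div_sub (η := η) hw.1.2)
      exact h3.congr_deriv (by rw [he, hl]; push_cast; ring)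
    · have h1 : HasDerivAt (fun y => z.2 - y) (-1) w.2 := by
        simpa using (hasDerivAt_id w.2).const_sub z.2
      have h3 := ((((((h1.pow 2).const_mul N).const_add (c * (z.1 - w.1) ^ 2)).add
        (h1.const_mul (g l))).add_const (α * softAbs 1 z.2)).add_const
        (η / (T - z.1))).add_const (η / (T - w.1))
      exact h3.congr_deriv (by rw [hq]; push_cast; ring)
  rw [neg_neg] at hsup
  have hηT : ∀ t ∈ Ioo 0 T, 4 * δ ≤ η / (T - t) ^ 2 := by
    intro t ht
    have h1 : 0 < T - t := sub_pos.2 ht.2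
    rw [le_div_iff₀ (by positivity)]
    refine le_trans (mul_le_mul_of_nonneg_left ?_ (by positivity)) hη
    exact pow_le_pow_left₀ h1.le (by linarith [ht.1]) 2
  have h4z := hηT z.1 hz.1
  have h4w := hηT w.1 hw.1
  have hgl' := abs_lt.1 (hgG l)
  have he' := abs_le.1 hg'
  have hsubH : (l + e + η / (T - z.1) ^ 2) + H (q + a) ≤ 0 := by
    refine hsub.resolve_right ?_
    rintro ⟨hx, h⟩
    have ha' : a = 0 := by rw [ha, hx]; simp
    have hqg : q ≤ g l := by
      rw [hq, hx]
      linarith [mul_nonneg (mul_nonneg zero_le_two hN) hy0]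
    rw [ha', add_zero] at h
    linarith [hGF q, hGmono hqg, hgl'.1, he'.1]
  rcases hsup with h | ⟨hy, h⟩
  · have := (abs_lt.1 (hHq a haα)).1
    linarith
  · have hqg : g l ≤ q := by
      rw [hq, hy]
      linarith [mul_nonneg (mul_nonneg zero_le_two hN) hx0]
    have hFq : G q = F q := hGB q a ha0 (by linarith [neg_abs_le l, he'.1])
    linarith [hGmono hqg, hgl'.2, he'.2]

lemma exists_pos_forall_abs_sub_lt {H : ℝ → ℝ} (hH : Continuous H) (Q : ℝ) {δ : ℝ} (hδ : 0 < δ) :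
    ∃ α, 0 < α ∧ ∀ q a, |q| ≤ Q → |a| ≤ α → |H (q + a) - H q| < δ := by
  have h1 := isCompact_Icc (a := -(Q + 1)) (b := Q + 1) |>.uniformContinuousOn_of_continuous
    hH.continuousOn
  obtain ⟨r, hr, h⟩ := Metric.uniformContinuousOn_iff.1 h1 δ hδ
  refine ⟨min (r / 2) 1, by positivity, fun q a hq ha => ?_⟩
  have h2 : |a| ≤ r / 2 := ha.trans (min_le_left _ _)
  have h3 : |a| ≤ 1 := ha.trans (min_le_right _ _)
  rw [← Real.dist_eq]
  refine h _ (abs_le.1 ((abs_add_le q a).trans (by linarith))) _ (abs_le.1 (by linarith)) ?_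
  rw [Real.dist_eq, add_sub_cancel_left]
  linarith

/-- A pair of points at which the doubled function is at least `m / 2` has nearly equal space
coordinates, positive times, and stays in a bounded region away from the final time. -/
lemma localization_of_le_doubling {g : ℝ → ℝ} {T c N α η m K L A Γ r : ℝ} {U W : ℝ × ℝ → ℝ}
    (hbound : ∀ z ∈ dom T, ∀ w ∈ dom T, U z + W w ≤ m / 8 + K * (z.1 + w.1) + L * |z.2 - w.2|)
    (hK : 0 ≤ K) (hL : 0 ≤ L) (hm : 0 < m) (hη : 0 < η) (hα : 0 < α)
    (hA : A = m / 8 + 2 * K * T) (hA0 : 0 ≤ A)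
    (hc : c = (K ^ 2 + 1) * (A + 1) / (m / 8) ^ 2)
    (hg : ∀ l, |l| ≤ 2 * c * T → |g l| ≤ Γ) (hΓ : 0 ≤ Γ) (hr : 0 < r)
    (hr₁ : (L + Γ) * r ≤ 1) (hr₂ : (L + Γ) * r ≤ m / 8) (hN : N = A / r ^ 2 + (L + Γ) / r + 1)
    {z w : ℝ × ℝ} (hz : z ∈ dom T) (hw : w ∈ dom T)
    (h : m / 2 ≤ U z + W w - penalty g T c N α η (z, w)) :
    |2 * c * (z.1 - w.1)| ≤ 2 * c * T ∧ |z.2 - w.2| ≤ r ∧ 0 < z.1 ∧ 0 < w.1 ∧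
      α * z.2 ≤ A + 1 ∧ η ≤ (A + 1) * (T - z.1) ∧ η ≤ (A + 1) * (T - w.1) := by
  have hc0 : 0 < c := by rw [hc]; positivity
  obtain ⟨⟨ht0, htT⟩, hx0⟩ := hz
  obtain ⟨⟨hs0, hsT⟩, hy0⟩ := hw
  have hUW := hbound z ⟨⟨ht0, htT⟩, hx0⟩ w ⟨⟨hs0, hsT⟩, hy0⟩
  simp only [mem_Ici] at hx0 hy0
  have hlT : |2 * c * (z.1 - w.1)| ≤ 2 * c * T := by
    rw [abs_mul, abs_of_pos (by positivity : 0 < 2 * c)]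
    refine mul_le_mul_of_nonneg_left (abs_le.2 ⟨?_, ?_⟩) (by positivity) <;> linarith
  set d := |z.2 - w.2| with hd
  have hd0 : 0 ≤ d := abs_nonneg _
  have hgd : -(Γ * d) ≤ g (2 * c * (z.1 - w.1)) * (z.2 - w.2) := by
    refine neg_le_of_abs_le ?_
    rw [abs_mul]
    exact mul_le_mul_of_nonneg_right (hg _ hlT) hd0
  have hdsq : (z.2 - w.2) ^ 2 = d ^ 2 := (sq_abs _).symm
  have hψ : α * z.2 ≤ α * softAbs 1 z.2 :=
    mul_le_mul_of_nonneg_left ((le_abs_self _).trans (abs_le_softAbs 1 _)) hα.le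
  have hTt : 0 < T - z.1 := sub_pos.2 htT
  have hTs : 0 < T - w.1 := sub_pos.2 hsT
  have hηt : 0 < η / (T - z.1) := div_pos hη hTt
  have hηs : 0 < η / (T - w.1) := div_pos hη hTs
  have hαx : 0 ≤ α * z.2 := mul_nonneg hα.le hx0
  have hc2 : 0 ≤ c * (z.1 - w.1) ^ 2 := mul_nonneg hc0.le (sq_nonneg _)
  have hN0 : 0 < N := by rw [hN]; positivity
  have hNd : 0 ≤ N * d ^ 2 := by positivity
  have hKt : K * (z.1 + w.1) ≤ 2 * K * T := by
    have := mul_le_mul_of_nonneg_left (show z.1 + w.1 ≤ 2 * T by linarith) hK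
    linarith
  simp only [penalty] at h
  rw [hdsq] at h
  have hdr : d ≤ r := by
    by_contra! hlt
    have h1 : 1 ≤ d / r := (one_le_div hr).2 hlt.le
    have h2 : N * d ^ 2 = A * (d / r) ^ 2 + (L + Γ) * d * (d / r) + d ^ 2 := by
      rw [hN]; field_simp
    have h3 : A ≤ A * (d / r) ^ 2 := le_mul_of_one_le_right hA0 (one_le_pow₀ h1)
    have h4 : (L + Γ) * d ≤ (L + Γ) * d * (d / r) := le_mul_of_one_le_right (by positivity) h1
    have h5 : 0 ≤ d ^ 2 := by positivity
    linarith
  have hLd : (L + Γ) * d ≤ (L + Γ) * r := mul_le_mul_of_nonneg_left hdr (by positivity)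
  have hLd₁ : (L + Γ) * d ≤ 1 := hLd.trans hr₁
  have hKτ : K * |z.1 - w.1| ≤ m / 8 := by
    have h1 : c * (z.1 - w.1) ^ 2 ≤ A + 1 := by linarith
    have h2 : c * (m / 8) ^ 2 = (K ^ 2 + 1) * (A + 1) := by rw [hc]; field_simp
    refine abs_le_of_sq_le_sq' ?_ (by positivity) |>.2
    rw [mul_pow, sq_abs]
    have h3 : c * (K ^ 2 * (z.1 - w.1) ^ 2) ≤ c * (m / 8) ^ 2 := by
      have := mul_le_mul_of_nonneg_left h1 (sq_nonneg K)
      linarith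
    exact le_of_mul_le_mul_left h3 hc0
  refine ⟨hlT, hdr, ?_, ?_, by linarith, ?_, ?_⟩
  · refine lt_of_le_of_ne ht0 fun h0 => ?_
    rw [← h0, zero_sub, abs_neg, abs_of_nonneg hs0] at hKτ
    rw [← h0, zero_add] at hUW
    linarith
  · refine lt_of_le_of_ne hs0 fun h0 => ?_
    rw [← h0, sub_zero, abs_of_nonneg ht0] at hKτ
    rw [← h0, add_zero] at hUW
    linarith
  · rw [← div_le_iff₀ hTt]; linarith
  · rw [← div_le_iff₀ hTs]; linarith

/-- Comparison for a sub-solution `U` and the opposite `W` of a super-solution, given a modulus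
bound that controls `U + W` off the diagonal and near the initial time. -/
theorem ViscSub.add_nonpos {H F : ℝ → ℝ} {T : ℝ} {U W : ℝ × ℝ → ℝ}
    (hH : Continuous H) (hF : Continuous F) (hFmono : Antitone F) (hFsemi : Tendsto F atBot atTop)
    (hcase : Tendsto F atTop atBot ∨ Tendsto H (cocompact ℝ) atTop)
    (hU : ViscSub H F T U) (hW : ViscSub (fun p => -H (-p)) (fun p => -F (-p)) T W)
    (hUsc : UpperSemicontinuousOn U (dom T)) (hWsc : UpperSemicontinuousOn W (dom T))
    (hmod : ∀ θ, 0 < θ → ∃ K L, 0 ≤ K ∧ 0 ≤ L ∧ ∀ z ∈ dom T, ∀ w ∈ dom T,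
      U z + W w ≤ θ + K * (z.1 + w.1) + L * |z.2 - w.2|) :
    ∀ z ∈ dom T, U z + W z ≤ 0 := by
  by_contra! hcon
  obtain ⟨z₁, hz₁, hm⟩ := hcon
  set m := U z₁ + W z₁ with hm_def
  have hT₁ : 0 < T - z₁.1 := sub_pos.2 hz₁.1.2
  have hT : 0 < T := hz₁.1.1.trans_lt hz₁.1.2
  -- the constants, each depending only on the previous ones
  set η := m / 8 * (T - z₁.1) with hη
  have hη0 : 0 < η := by positivity
  obtain ⟨K, L, hK, hL, hbound⟩ := hmod (m / 8) (by positivity)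
  obtain ⟨A, hA⟩ : ∃ A, A = m / 8 + 2 * K * T := ⟨_, rfl⟩
  have hA0 : 0 ≤ A := by rw [hA]; positivity
  obtain ⟨c, hc⟩ : ∃ c, c = (K ^ 2 + 1) * (A + 1) / (m / 8) ^ 2 := ⟨_, rfl⟩
  have hc0 : 0 < c := by rw [hc]; positivity
  obtain ⟨δ, hδ⟩ : ∃ δ, δ = η / (4 * T ^ 2) := ⟨_, rfl⟩
  have hδ0 : 0 < δ := by rw [hδ]; positivity
  obtain ⟨G, hG, hGmono, hGbot, hGtop, hGF, hGB⟩ :=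
    exists_coercive_modification hF hFmono hFsemi hcase (2 * c * T + δ)
  obtain ⟨g, hg, hgG⟩ := exists_smooth_approx_inverse hG hGmono hGbot hGtop hδ0
  obtain ⟨Γ, hΓ, hgΓ⟩ := exists_abs_le_of_abs_le hg.continuous (2 * c * T)
  obtain ⟨Γ', hΓ', hgΓ'⟩ := exists_abs_le_of_abs_le (hg.continuous_deriv le_rfl) (2 * c * T)
  obtain ⟨r, hr, hr₁, hr₂, hr₃⟩ : ∃ r, 0 < r ∧ (L + Γ) * r ≤ 1 ∧ (L + Γ) * r ≤ m / 8 ∧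
      Γ' * (2 * c) * r ≤ δ := by
    have key : ∀ a b : ℝ, 0 ≤ a → 0 < b → ∀ᶠ r in 𝓝[>] (0 : ℝ), a * r ≤ b := by
      intro a b ha hb
      have : Tendsto (fun r : ℝ => a * r) (𝓝 0) (𝓝 (a * 0)) := by
        exact (continuous_const_mul a).tendsto 0
      rw [mul_zero] at this
      exact nhdsWithin_le_nhds ((this.eventually_lt_const hb).mono fun _ h => h.le)
    obtain ⟨r, hr⟩ := ((eventually_mem_nhdsWithin (a := (0 : ℝ)) (s := Ioi 0)).and
      ((key (L + Γ) 1 (by positivity) one_pos).and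
      ((key (L + Γ) (m / 8) (by positivity) (by positivity)).and
        (key (Γ' * (2 * c)) δ (by positivity) hδ0)))).exists
    exact ⟨r, hr.1, hr.2.1, hr.2.2.1, hr.2.2.2⟩
  obtain ⟨N, hN⟩ : ∃ N, N = A / r ^ 2 + (L + Γ) / r + 1 := ⟨_, rfl⟩
  have hN0 : 0 < N := by rw [hN]; positivity
  obtain ⟨α₀, hα₀, hHα⟩ := exists_pos_forall_abs_sub_lt hH (2 * N * r + Γ)
    (show 0 < 8 * δ by positivity)
  have hψ := softAbs_pos one_pos z₁.2
  obtain ⟨α, hα, hαα₀, hαm⟩ : ∃ α, 0 < α ∧ α ≤ α₀ ∧ α * softAbs 1 z₁.2 ≤ m / 4 :=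
    ⟨min α₀ (m / 4 / softAbs 1 z₁.2), by positivity, min_le_left _ _,
      (le_div_iff₀ hψ).1 (min_le_right _ _)⟩
  have hloc := fun z (hz : z ∈ dom T) w (hw : w ∈ dom T) =>
    localization_of_le_doubling (z := z) (w := w) (α := α) (N := N) hbound hK hL hm hη0 hα hA hA0
      hc hgΓ hΓ hr hr₁ hr₂ hN hz hw
  have href : m / 2 ≤ U z₁ + W z₁ - penalty g T c N α η (z₁, z₁) := by
    have h1 : η / (T - z₁.1) = m / 8 := by rw [hη]; field_simp
    simp only [penalty, sub_self, h1]
    linarith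
  set b := (A + 1) / α with hb
  set τ := η / (A + 1) with hτ
  have hτ0 : 0 < τ := by positivity
  have hsub : ((Icc 0 (T - τ) ×ˢ Icc 0 b) ×ˢ (Icc 0 (T - τ) ×ˢ Icc 0 (b + r)) :
      Set ((ℝ × ℝ) × (ℝ × ℝ))) ⊆ dom T ×ˢ dom T := by
    intro p hp
    exact ⟨⟨⟨hp.1.1.1, by linarith [hp.1.1.2]⟩, hp.1.2.1⟩,
      ⟨⟨hp.2.1.1, by linarith [hp.2.1.2]⟩, hp.2.2.1⟩⟩
  obtain ⟨⟨z, w⟩, ⟨hz, hw⟩, hmax⟩ := exists_forall_le_of_superlevel_subset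
    (f := fun p : (ℝ × ℝ) × (ℝ × ℝ) => U p.1 + W p.2 - penalty g T c N α η p)
    (S := dom T ×ˢ dom T) (z₀ := (z₁, z₁))
    ((isCompact_Icc.prod isCompact_Icc).prod (isCompact_Icc.prod isCompact_Icc)) hsub
    (by
      have h1 : UpperSemicontinuousOn (fun p : (ℝ × ℝ) × (ℝ × ℝ) => U p.1) (dom T ×ˢ dom T) :=
        hUsc.comp continuous_fst.continuousOn fun p hp => hp.1
      have h2 : UpperSemicontinuousOn (fun p : (ℝ × ℝ) × (ℝ × ℝ) => W p.2) (dom T ×ˢ dom T) :=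
        hWsc.comp continuous_snd.continuousOn fun p hp => hp.2
      have h3 := ((h1.add h2).add
        (contDiffOn_penalty hg T c N α η).continuousOn.neg.upperSemicontinuousOn).mono hsub
      simpa only [sub_eq_add_neg] using! h3)
    ⟨hz₁, hz₁⟩ (by
      rintro ⟨z, w⟩ ⟨hz, hw⟩ hle
      obtain ⟨-, hd, -, -, hx, ht, hs⟩ := hloc z hz w hw (href.trans hle)
      have hzb : z.2 ≤ b := by rw [hb, le_div_iff₀ hα]; linarith
      have hA1 : 0 < A + 1 := by positivity
      refine ⟨⟨⟨hz.1.1, ?_⟩, hz.2, hzb⟩, ⟨hw.1.1, ?_⟩, hw.2, ?_⟩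
      · have : τ ≤ T - z.1 := by rw [hτ, div_le_iff₀ hA1]; linarith
        linarith
      · have : τ ≤ T - w.1 := by rw [hτ, div_le_iff₀ hA1]; linarith
        linarith
      · linarith [(abs_le.1 hd).1])
  obtain ⟨hl, hd, ht, hs, -⟩ := hloc z hz w hw (href.trans (hmax (z₁, z₁) ⟨hz₁, hz₁⟩))
  refine false_of_isMax_doubling (c := c) (N := N) (α := α) (η := η) (z := z) (w := w) hU hW
    hGmono hGF hGB hg hgG hN0.le hα.le ?_ ⟨⟨ht, hz.1.2⟩, hz.2⟩ ⟨⟨hs, hw.1.2⟩, hw.2⟩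
    (fun z' hz' w' hw' => hmax (z', w') ⟨hz', hw'⟩) ?_ (by linarith)
    fun a ha => hHα _ a ?_ (ha.trans hαα₀)
  · rw [hδ]; field_simp; rfl
  · rw [abs_mul, abs_mul, abs_of_pos (show 0 < 2 * c by positivity)]
    have h1 := hgΓ' _ hl
    calc _ ≤ Γ' * (2 * c) * r := by gcongr
      _ ≤ δ := hr₃
  · refine (abs_add_le _ _).trans (add_le_add ?_ (hgΓ _ hl))
    rw [abs_mul, abs_of_pos (show 0 < 2 * N by positivity)]
    gcongr

end HalfLineHJ

theorem theorem1p2 (H F u₀ : ℝ → ℝ)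
    (hH : Continuous H) (hF : Continuous F) (hFmono : Antitone F)
    (hFsemi : Tendsto F atBot atTop)
    (hu₀ : UniformContinuousOn u₀ (Ici 0))
    (hcase : Tendsto F atTop atBot ∨ Tendsto H (cocompact ℝ) atTop)
    (T C : ℝ) (hT : 0 < T) (hC : 0 < C) (u v : ℝ × ℝ → ℝ)
    (hu : HalfLineHJ.IsRelaxedSubIVP H F u₀ T u)
    (hv : HalfLineHJ.IsRelaxedSuperIVP H F u₀ T v)
    (hub : ∀ t ∈ Ioo 0 T, ∀ x : ℝ, 0 ≤ x → u (t, x) ≤ C * (1 + x))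
    (hvb : ∀ t ∈ Ioo 0 T, ∀ x : ℝ, 0 ≤ x → -C * (1 + x) ≤ v (t, x)) :
    ∀ t ∈ Ico 0 T, ∀ x : ℝ, 0 ≤ x → u (t, x) ≤ v (t, x) := by
  obtain ⟨U, hUsc, huU, hUC, hU0, hU⟩ := HalfLineHJ.exists_viscSub hu hub
  obtain ⟨W, hWsc, hvW, hWC, hW0, hW⟩ := HalfLineHJ.exists_viscSub hv.neg (C := C)
    (fun t ht x hx => by linarith [hvb t ht x hx])
  have hmod : ∀ θ, 0 < θ → ∃ K L, 0 ≤ K ∧ 0 ≤ L ∧ ∀ z ∈ HalfLineHJ.dom T,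
      ∀ w ∈ HalfLineHJ.dom T, U z + W w ≤ θ + K * (z.1 + w.1) + L * |z.2 - w.2| := by
    intro θ hθ
    obtain ⟨L₀, hL₀, hLip⟩ := HalfLineHJ.exists_lipschitz_add_error hu₀
      (show 0 < θ / 3 by positivity)
    -- barriers have to grow faster than the solutions, hence the enlarged slope
    set L := L₀ + C + 1 with hL
    have hL0 : 0 ≤ L := by positivity
    have hLip' : ∀ x y, 0 ≤ x → 0 ≤ y → |u₀ x - u₀ y| ≤ θ / 3 + L * |x - y| := by
      intro x y hx hy
      have := mul_nonneg (show 0 ≤ C + 1 by positivity) (abs_nonneg (x - y))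
      linarith [hLip x y hx hy]
    obtain ⟨K₁, hK₁, h₁⟩ := hU.exists_le_add_mul (δ := θ / 3) hH hF hUsc hUC
      (fun x hx => hU0 x hx hT) hL0 (show C < L by linarith)
      (fun x y hx hy => by linarith [(abs_le.1 (hLip' x y hx hy)).2])
    obtain ⟨K₂, hK₂, h₂⟩ := hW.exists_le_add_mul (δ := θ / 3) (by fun_prop) (by fun_prop) hWsc
      hWC (fun x hx => hW0 x hx hT) hL0 (show C < L by linarith)
      (fun x y hx hy => by linarith [(abs_le.1 (hLip' x y hx hy)).1])
    refine ⟨K₁ + K₂, L, by positivity, hL0, fun z hz w hw => ?_⟩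
    have h3 := (abs_le.1 (hLip' z.2 w.2 hz.2 hw.2)).2
    have h4 := mul_nonneg hK₁ hw.1.1
    have h5 := mul_nonneg hK₂ hz.1.1
    linarith [h₁ z hz, h₂ w hw]
  intro t ht x hx
  have hz : (t, x) ∈ HalfLineHJ.dom T := ⟨ht, hx⟩
  have := hU.add_nonpos hH hF hFmono hFsemi hcase hW hUsc hWsc hmod (t, x) hz
  linarith [huU _ hz, hvW _ hz]
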